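/- Let $\mathrm{APr}_A$ be the continuous first-order theory whose models are the pairs $(\mathcal B,\tau)$, where $\mathcal B$ is an atomless probability algebra with metric $d(a,b)=\mu(a\mathbin{\triangle}b)$, in the language $\{0,1,{}^c,\cup,\cap,\tau\}$, and $\tau$ is an aperiodic automorphism of $\mathcal B$ (for every event $a\neq 0$ and every $n>0$ there is $b\subseteq a$ with $\tau^n(b)\neq b$). Let $S_n(\mathrm{APr}_A)$ be the space of complete $n$-types over $\emptyset$, with the distance $d(p,q)=\inf\{d(a,b): a\models p,\ b\models q\}$, the infimum being over realisations in a common model. A theory is called small if this metric on its space of $n$-types is separable for every $n\in\mathbb N$. For irrational $\alpha$ let $p_\alpha\in S_1(\mathrm{APr}_A)$ be the type of a half-circle in the probability algebra of the circle (with normalised Lebesgue measure), on which $\tau$ acts by rotation by $2\pi\alpha$. Lemma 3.3. (i) The theory $\mathrm{APr}_A$ is not small. (ii) If $\alpha,\beta$ are irrational numbers such that $1,\alpha,\beta$ are linearly independent over $\mathbb Q$, then $d(p_\alpha,p_\beta)\ge\frac12$. (iii) There is a set of types of the form $p_\alpha$ ($\alpha$ irrational) that has the cardinality of the continuum and any two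 distinct members of which are at distance at least $\frac12$; in particular, there is an uncountable family of types over the empty set every two of which have distance at least $\frac12$. -/

import Mathlib

open MeasureTheory Set
open scoped symmDiff ENNReal unitInterval Cardinal

noncomputable section

namespace APrA

/-! ### Probability algebras and their automorphisms -/

/-- A probability algebra: a Boolean algebra with a complete metric such that, writing
`μ x = dist ⊥ x`, one has `dist x y = μ (x ∆ y)`, `μ x + μ y = μ (x ⊓ y) + μ (x ⊔ y)` and
`μ ⊤ = 1`. -/
class IsProbabilityAlgebra (B : Type*) [BooleanAlgebra B] [MetricSpace B] : Prop where
  complete : CompleteSpace B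
  dist_eq : ∀ x y : B, dist x y = dist ⊥ (x ∆ y)
  modular : ∀ x y : B, dist ⊥ x + dist ⊥ y = dist ⊥ (x ⊓ y) + dist ⊥ (x ⊔ y)
  dist_bot_top : dist (⊥ : B) ⊤ = 1

theorem IsProbabilityAlgebra.dist_le_one {B : Type*} [BooleanAlgebra B] [MetricSpace B]
    [IsProbabilityAlgebra B] (x y : B) : dist x y ≤ 1 := by
  rw [IsProbabilityAlgebra.dist_eq]
  have h := IsProbabilityAlgebra.modular (x ∆ y) (x ∆ y)ᶜ
  rw [inf_compl_self, sup_compl_eq_top, dist_self, IsProbabilityAlgebra.dist_bot_top] at h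
  have := dist_nonneg (x := (⊥ : B)) (y := (x ∆ y)ᶜ)
  linarith

/-- Every event contains an event of exactly half its measure. -/
def IsAtomless (B : Type*) [BooleanAlgebra B] [MetricSpace B] : Prop :=
  ∀ a : B, ∃ c : B, dist ⊥ (a ⊓ c) = dist ⊥ a / 2

/-- For every non-zero event `a` and `n > 0` there is a sub-event `b` of `a` that is moved by the
`n`-th power of `τ`. -/
def IsAperiodic {B : Type*} [BooleanAlgebra B] (τ : B ≃o B) : Prop :=
  ∀ a : B, a ≠ ⊥ → ∀ n : ℕ, 0 < n → ∃ b : B, b ≤ a ∧ τ^[n] b ≠ b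

/-- The models of the theory `APr_A`: atomless probability algebras with a distinguished
aperiodic automorphism (a Boolean automorphism that preserves the measure, hence the metric). -/
structure Model where
  carrier : Type
  [boolean : BooleanAlgebra carrier]
  [metric : MetricSpace carrier]
  [probability : IsProbabilityAlgebra carrier]
  τ : carrier ≃o carrier
  isometry : Isometry τ
  atomless : IsAtomless carrier
  aperiodic : IsAperiodic τ

instance : CoeSort Model Type := ⟨Model.carrier⟩
instance (M : Model) : BooleanAlgebra M := M.boolean
instance (M : Model) : MetricSpace M := M.metric
instance (M : Model) : IsProbabilityAlgebra M := M.probability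

/-! ### Continuous logic in the language of probability algebras with an automorphism -/

/-- The function symbols `0, 1, ᶜ, ∪, ∩, τ`. -/
inductive Symb : ℕ → Type
  | zero : Symb 0
  | one : Symb 0
  | compl : Symb 1
  | union : Symb 2
  | inter : Symb 2
  | tau : Symb 1

/-- The language of probability algebras with an additional unary function symbol; the only
predicate is the distance, which is treated as a logical symbol. -/
def lang : FirstOrder.Language := ⟨Symb, fun _ => Empty⟩

instance (M : Model) : lang.Structure M where
  funMap {_} f := match f with
    | Symb.zero => fun _ => (⊥ : M)
    | Symb.one => fun _ => (⊤ : M)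
    | Symb.compl => fun x => (x 0)ᶜ
    | Symb.union => fun x => x 0 ⊔ x 1
    | Symb.inter => fun x => x 0 ⊓ x 1
    | Symb.tau => fun x => M.τ (x 0)
  RelMap r := r.elim

/-- Formulas of continuous first-order logic with free variables indexed by `Fin n`. The atomic
formulas are distances of terms, the connectives are all continuous functions
`[0,1]^k → [0,1]`, and the quantifiers are `sup` and `inf` over the last variable. -/
inductive Formula : ℕ → Type
  | dist {n : ℕ} (s t : lang.Term (Fin n)) : Formula n
  | connective {n k : ℕ} (u : C(Fin k → I, I)) (φ : Fin k → Formula n) : Formula n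
  | sup {n : ℕ} (φ : Formula (n + 1)) : Formula n
  | inf {n : ℕ} (φ : Formula (n + 1)) : Formula n

/-- The truth value in `[0,1]` of a formula at a tuple of a model. -/
def Formula.value (M : Model) : {n : ℕ} → Formula n → (Fin n → M) → I
  | _, .dist s t, a =>
      ⟨Dist.dist (s.realize a) (t.realize a), dist_nonneg, IsProbabilityAlgebra.dist_le_one _ _⟩
  | _, .connective u φ, a => u fun i => (φ i).value M a
  | _, .sup φ, a => ⨆ x : M, φ.value M (Fin.snoc a x)
  | _, .inf φ, a => ⨅ x : M, φ.value M (Fin.snoc a x)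

/-- The complete type over `∅` of a tuple, as the assignment of truth values to formulas. -/
def tp {M : Model} {n : ℕ} (a : Fin n → M) : Formula n → I := fun φ => φ.value M a

/-- `S_n(APr_A)`: the complete `n`-types over `∅` realised in models of `APr_A`. (As the language
is countable, it makes no difference that the models have their carrier in `Type`.) -/
def TypeSpace (n : ℕ) : Type := {p : Formula n → I // ∃ (M : Model) (a : Fin n → M), tp a = p}

/-- The type of a tuple, as a point of the type space. -/
def typeOf {M : Model} {n : ℕ} (a : Fin n → M) : TypeSpace n := ⟨tp a, M, a, rfl⟩

/-- The distance between two types: the infimum of the distances of realisations in a common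
model (distances of tuples being the maximum over the coordinates). As usual, an infimum over no
realisations at all would be `∞`. -/
def typeDist {n : ℕ} (p q : TypeSpace n) : ℝ≥0∞ :=
  ⨅ (M : Model) (a : Fin n → M) (b : Fin n → M) (_ : typeOf a = p) (_ : typeOf b = q), edist a b

/-- The theory is small: for every `n`, the metric on the space of `n`-types is separable, i.e.
there is a countable set of types that is dense for the metric. -/
def IsSmall : Prop :=
  ∀ n : ℕ, ∃ D : Set (TypeSpace n), D.Countable ∧
    ∀ p : TypeSpace n, ∀ ε : ℝ≥0∞, 0 < ε → ∃ q ∈ D, typeDist p q < ε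

/-! ### The probability algebra of a probability space -/

section MeasureAlgebra

variable {X : Type} [MeasurableSpace X] (μ : Measure X)

/-- The measure algebra of a measure: measurable sets, with distance `μ (A ∆ B)`, modulo being at
distance zero. -/
abbrev MeasureAlgebra : Type := SeparationQuotient (MeasuredSets μ)

variable {μ}

/-- A measurable set, as an element of `MeasuredSets μ`. -/
def measuredSet (μ : Measure X) (A : Set X) (hA : MeasurableSet A) : MeasuredSets μ := ⟨A, hA⟩

/-- The event determined by a measurable set. -/
def event (μ : Measure X) (A : Set X) (hA : MeasurableSet A) : MeasureAlgebra μ :=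
  SeparationQuotient.mk (measuredSet μ A hA)

theorem event_eq_iff {A B : Set X} {hA : MeasurableSet A} {hB : MeasurableSet B} :
    event μ A hA = event μ B hB ↔ A =ᵐ[μ] B := by
  rw [event, event, SeparationQuotient.mk_eq_mk, EMetric.inseparable_iff,
    ← measure_symmDiff_eq_zero_iff]
  exact Iff.rfl

theorem event_ind {P : MeasureAlgebra μ → Prop} (h : ∀ A hA, P (event μ A hA)) (a) : P a := by
  obtain ⟨⟨A, hA⟩, rfl⟩ := SeparationQuotient.surjective_mk a
  exact h A hA

theorem ae_eq_of_insep {A B : MeasuredSets μ} (h : Inseparable A B) :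
    (A : Set X) =ᵐ[μ] (B : Set X) := by
  rw [EMetric.inseparable_iff] at h
  exact measure_symmDiff_eq_zero_iff.1 h

instance : Max (MeasureAlgebra μ) where
  max := SeparationQuotient.lift₂ (fun A B => event μ (A.1 ∪ B.1) (A.2.union B.2))
    fun _ _ _ _ h h' => event_eq_iff.2 ((ae_eq_of_insep h).union (ae_eq_of_insep h'))

instance : Min (MeasureAlgebra μ) where
  min := SeparationQuotient.lift₂ (fun A B => event μ (A.1 ∩ B.1) (A.2.inter B.2))
    fun _ _ _ _ h h' => event_eq_iff.2 ((ae_eq_of_insep h).inter (ae_eq_of_insep h'))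

instance : Compl (MeasureAlgebra μ) where
  compl := SeparationQuotient.lift (fun A => event μ A.1ᶜ A.2.compl)
    fun _ _ h => event_eq_iff.2 (ae_eq_of_insep h).compl

theorem event_sup (A B : Set X) (hA : MeasurableSet A) (hB : MeasurableSet B) :
    event μ A hA ⊔ event μ B hB = event μ (A ∪ B) (hA.union hB) := rfl

theorem event_inf (A B : Set X) (hA : MeasurableSet A) (hB : MeasurableSet B) :
    event μ A hA ⊓ event μ B hB = event μ (A ∩ B) (hA.inter hB) := rfl

theorem event_compl (A : Set X) (hA : MeasurableSet A) :
    (event μ A hA)ᶜ = event μ Aᶜ hA.compl := rfl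

theorem event_congr {A B : Set X} (h : A = B) {hA : MeasurableSet A} {hB : MeasurableSet B} :
    event μ A hA = event μ B hB := by subst h; rfl

instance : Lattice (MeasureAlgebra μ) := Lattice.mk'
  (fun a b => by
    induction a using event_ind; induction b using event_ind
    simp only [event_sup]; exact event_congr (union_comm _ _))
  (fun a b c => by
    induction a using event_ind; induction b using event_ind; induction c using event_ind
    simp only [event_sup]; exact event_congr (union_assoc _ _ _))
  (fun a b => by
    induction a using event_ind; induction b using event_ind
    simp only [event_inf]; exact event_congr (inter_comm _ _))
  (fun a b c => by
    induction a using event_ind; induction b using event_ind; induction c using event_ind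
    simp only [event_inf]; exact event_congr (inter_assoc _ _ _))
  (fun a b => by
    induction a using event_ind; induction b using event_ind
    simp only [event_inf, event_sup]; exact event_congr (by simp))
  (fun a b => by
    induction a using event_ind; induction b using event_ind
    simp only [event_inf, event_sup]; exact event_congr (by simp))

instance : DistribLattice (MeasureAlgebra μ) := DistribLattice.ofInfSupLe fun a b c => le_of_eq <| by
  induction a using event_ind; induction b using event_ind; induction c using event_ind
  simp only [event_inf, event_sup]; exact event_congr (inter_union_distrib_left _ _ _)

instance : Top (MeasureAlgebra μ) := ⟨event μ univ .univ⟩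
instance : Bot (MeasureAlgebra μ) := ⟨event μ ∅ .empty⟩

theorem event_univ : event μ univ .univ = ⊤ := rfl
theorem event_empty : event μ ∅ .empty = ⊥ := rfl

instance : BooleanAlgebra (MeasureAlgebra μ) where
  inf_compl_le_bot a := le_of_eq <| by
    induction a using event_ind
    simp only [event_inf, event_compl, ← event_empty]; exact event_congr (by simp)
  top_le_sup_compl a := le_of_eq <| by
    induction a using event_ind
    simp only [event_sup, event_compl, ← event_univ]; exact event_congr (by simp)
  le_top a := by
    induction a using event_ind
    rw [← inf_eq_left, ← event_univ, event_inf]; exact event_congr (by simp)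
  bot_le a := by
    induction a using event_ind
    rw [← inf_eq_left, ← event_empty, event_inf]; exact event_congr (by simp)

theorem event_symmDiff (A B : Set X) (hA : MeasurableSet A) (hB : MeasurableSet B) :
    event μ A hA ∆ event μ B hB = event μ (A ∆ B) (hA.symmDiff hB) := by
  simp only [symmDiff, sdiff_eq]
  rfl

theorem event_le_event {A B : Set X} (hA : MeasurableSet A) (hB : MeasurableSet B) (h : A ⊆ B) :
    event μ A hA ≤ event μ B hB := by
  rw [← inf_eq_left, event_inf]; exact event_congr (inter_eq_left.2 h)

theorem dist_event [IsFiniteMeasure μ] (A B : Set X) (hA : MeasurableSet A)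
    (hB : MeasurableSet B) : dist (event μ A hA) (event μ B hB) = μ.real (A ∆ B) := rfl

theorem dist_bot_event [IsFiniteMeasure μ] (A : Set X) (hA : MeasurableSet A) :
    dist ⊥ (event μ A hA) = μ.real A := by
  rw [← event_empty, dist_event]; congr 1; exact bot_symmDiff A

theorem complete_measuredSets [IsFiniteMeasure μ] : CompleteSpace (MeasuredSets μ) := by
  refine EMetric.complete_of_convergent_controlled_sequences (fun n => (2⁻¹ : ℝ≥0∞) ^ n)
    (fun n => ENNReal.pow_pos (by simp) n) fun u hu => ?_
  let s : ℕ → Set X := fun n => (u n).1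
  have hs : ∀ n, MeasurableSet (s n) := fun n => (u n).2
  let t : Set X := ⋂ N, ⋃ n, s (N + n)
  have ht : MeasurableSet t := .iInter fun N => .iUnion fun n => hs _
  have hsub : ∀ N, s N ∆ t ⊆ ⋃ n, s (N + n) ∆ s (N + n + 1) := by
    intro N x hx
    by_contra hcon
    simp only [mem_iUnion, not_exists, mem_symmDiff, not_or, not_and, not_not] at hcon
    have key : ∀ n, x ∈ s (N + n) ↔ x ∈ s N := by
      intro n
      induction n with
      | zero => rfl
      | succ n ih => rw [← ih]; exact ⟨(hcon n).2, (hcon n).1⟩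
    have hxt : x ∈ t ↔ x ∈ s N := by
      simp only [t, mem_iInter, mem_iUnion]
      constructor
      · intro h
        obtain ⟨n, hn⟩ := h N
        exact (key n).1 hn
      · intro h M
        refine ⟨N, ?_⟩
        rw [add_comm]
        exact (key M).2 h
    rw [mem_symmDiff] at hx
    tauto
  have hbound : ∀ N, μ (s N ∆ t) ≤ (2⁻¹ : ℝ≥0∞) ^ N * 2 := by
    intro N
    calc μ (s N ∆ t) ≤ μ (⋃ n, s (N + n) ∆ s (N + n + 1)) := measure_mono (hsub N)
      _ ≤ ∑' n, μ (s (N + n) ∆ s (N + n + 1)) := measure_iUnion_le _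
      _ ≤ ∑' n, (2⁻¹ : ℝ≥0∞) ^ (N + n) :=
          ENNReal.tsum_le_tsum fun n => (hu (N + n) _ _ le_rfl (Nat.le_succ _)).le
      _ = (2⁻¹ : ℝ≥0∞) ^ N * 2 := by
          simp_rw [pow_add]
          rw [ENNReal.tsum_mul_left, ENNReal.tsum_geometric, ENNReal.one_sub_inv_two, inv_inv]
  refine ⟨measuredSet μ t ht, ?_⟩
  rw [tendsto_iff_edist_tendsto_0]
  have h0 : Filter.Tendsto (fun N : ℕ => (2⁻¹ : ℝ≥0∞) ^ N * 2) Filter.atTop (nhds 0) := by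
    have := ENNReal.Tendsto.mul_const (b := 2)
      (ENNReal.tendsto_pow_atTop_nhds_zero_of_lt_one (r := 2⁻¹) (by simp)) (Or.inr (by simp))
    simpa using this
  exact tendsto_of_tendsto_of_tendsto_of_le_of_le tendsto_const_nhds h0 (fun _ => zero_le)
    fun N => hbound N

instance [IsProbabilityMeasure μ] : IsProbabilityAlgebra (MeasureAlgebra μ) where
  complete := by
    have := complete_measuredSets (μ := μ)
    infer_instance
  dist_eq a b := by
    induction a using event_ind; induction b using event_ind
    rw [event_symmDiff, dist_bot_event, dist_event]
  modular a b := by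
    induction a using event_ind with | _ A hA
    induction b using event_ind with | _ B hB
    rw [event_inf, event_sup]
    simp only [dist_bot_event]
    rw [add_comm (μ.real (A ∩ B)), measureReal_union_add_inter hB]
  dist_bot_top := by
    rw [← event_univ, dist_bot_event]; simp

/-- A measure-preserving map acts on the measure algebra by preimages. -/
def pullback (f : X → X) (hf : MeasurePreserving f μ μ) : MeasureAlgebra μ → MeasureAlgebra μ :=
  SeparationQuotient.lift (fun A => event μ (f ⁻¹' A.1) (hf.measurable A.2))
    fun _ _ h => event_eq_iff.2 (hf.quasiMeasurePreserving.preimage_ae_eq (ae_eq_of_insep h))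

theorem pullback_event (f : X → X) (hf : MeasurePreserving f μ μ) (A : Set X)
    (hA : MeasurableSet A) :
    pullback f hf (event μ A hA) = event μ (f ⁻¹' A) (hf.measurable hA) := rfl

theorem pullback_mono (f : X → X) (hf : MeasurePreserving f μ μ) : Monotone (pullback f hf) := by
  intro a b h
  rw [← inf_eq_left] at h ⊢
  nth_rewrite 2 [← h]
  induction a using event_ind; induction b using event_ind
  rfl

end MeasureAlgebra

/-! ### Rotations of the circle -/

/-- The circle `ℝ / ℤ` with Lebesgue measure normalised to have total mass `1`. -/
abbrev Circle1 : Type := UnitAddCircle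

instance : IsProbabilityMeasure (volume : Measure Circle1) := ⟨UnitAddCircle.measure_univ⟩

/-- The probability algebra of the circle. -/
abbrev CircleAlgebra : Type := MeasureAlgebra (volume : Measure Circle1)

/-- The automorphism of the probability algebra of the circle that is induced by the rotation
`x ↦ x + α` (by the angle `2πα`): it sends an event `A` to the rotated event `α + A`, which is
the preimage of `A` under the inverse rotation. -/
def rotation (α : Circle1) : CircleAlgebra ≃o CircleAlgebra where
  toFun := pullback (-α + ·) (measurePreserving_add_left volume (-α))
  invFun := pullback (α + ·) (measurePreserving_add_left volume α)
  left_inv a := by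
    induction a using event_ind
    simp only [pullback_event]
    exact event_congr (by ext; simp)
  right_inv a := by
    induction a using event_ind
    simp only [pullback_event]
    exact event_congr (by ext; simp)
  map_rel_iff' {a b} := by
    refine ⟨fun h => ?_, fun h => pullback_mono (-α + ·) (measurePreserving_add_left volume (-α)) h⟩
    have h2 := pullback_mono (α + ·) (measurePreserving_add_left volume α) h
    induction a using event_ind
    induction b using event_ind
    simp only [Equiv.coe_fn_mk, pullback_event] at h2
    convert h2 using 1 <;> exact event_congr (by ext; simp)

theorem rotation_event (α : Circle1) (A : Set Circle1) (hA : MeasurableSet A) :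
    rotation α (event volume A hA) =
      event volume ((-α + ·) ⁻¹' A) ((measurable_const_add (-α)) hA) := rfl

theorem rotation_iterate (α : Circle1) (n : ℕ) (a : CircleAlgebra) :
    (rotation α)^[n] a = rotation (n • α) a := by
  induction n with
  | zero =>
    induction a using event_ind
    rw [rotation_event]
    exact event_congr (by ext; simp)
  | succ n ih =>
    rw [Function.iterate_succ_apply', ih]
    induction a using event_ind
    simp only [rotation_event]
    refine event_congr ?_
    ext x
    simp only [mem_preimage, succ_nsmul, neg_add_rev, add_assoc]
    rw [add_left_comm]

theorem isometry_rotation (α : Circle1) : Isometry (rotation α) := by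
  refine Isometry.of_dist_eq fun a b => ?_
  induction a using event_ind with | _ A hA
  induction b using event_ind with | _ B hB
  rw [rotation_event, rotation_event, dist_event, dist_event, ← preimage_symmDiff]
  exact (measurePreserving_add_left volume (-α)).measureReal_preimage
    (hA.symmDiff hB).nullMeasurableSet

theorem atomless_circle : IsAtomless CircleAlgebra := by
  intro a
  induction a using event_ind with | _ A hA
  let A' : Set ℝ := QuotientAddGroup.mk ⁻¹' A ∩ Ioc 0 (0 + 1)
  let g : ℝ → ℝ := fun t => volume.real (A' ∩ Iic t)
  have hfin : ∀ s : Set ℝ, volume (A' ∩ s) ≠ ∞ := fun s =>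
    measure_ne_top_of_subset (inter_subset_left.trans inter_subset_right) (by simp)
  have hg : Continuous g := by
    refine LipschitzWith.continuous (K := 1) (LipschitzWith.of_le_add fun t s => ?_)
    calc g t ≤ volume.real ((A' ∩ Iic s) ∪ uIcc s t) := by
          refine measureReal_mono ?_ ?_
          · rintro x ⟨hx, hxt⟩
            rcases le_or_gt x s with h | h
            · exact Or.inl ⟨hx, h⟩
            · exact Or.inr (Icc_subset_uIcc ⟨h.le, hxt⟩)
          · exact measure_union_ne_top (hfin _) (by simp [uIcc])
      _ ≤ g s + volume.real (uIcc s t) := measureReal_union_le _ _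
      _ = g s + dist t s := by
          rw [Measure.real, Real.volume_interval, Real.dist_eq, ENNReal.toReal_ofReal (abs_nonneg _)]
  have h0 : g 0 = 0 := by
    have : A' ∩ Iic 0 = ∅ := by
      ext x
      simp only [A', mem_inter_iff, mem_Ioc, mem_Iic, mem_empty_iff_false, iff_false]
      rintro ⟨⟨-, h, -⟩, h'⟩
      linarith
    simp [g, this]
  have hvol : ∀ U : Set Circle1, MeasurableSet U →
      volume.real U = volume.real (QuotientAddGroup.mk ⁻¹' U ∩ Ioc (0 : ℝ) (0 + 1)) := by
    intro U hU
    rw [Measure.real, Measure.real, AddCircle.add_projection_respects_measure 1 0 hU]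
  have h1 : g 1 = volume.real A := by
    rw [hvol A hA]
    have : A' ∩ Iic 1 = A' := by
      refine inter_eq_left.2 fun x hx => ?_
      have := hx.2.2
      simpa using this
    simp only [g, this, A']
  have hmem : volume.real A / 2 ∈ Icc (g 0) (g 1) := by
    have := measureReal_nonneg (μ := (volume : Measure Circle1)) (s := A)
    rw [h0, h1]
    constructor <;> linarith
  obtain ⟨t, -, ht⟩ := intermediate_value_Icc (zero_le_one' ℝ) hg.continuousOn hmem
  let C : Set Circle1 := (AddCircle.measurableEquivIoc 1 0) ⁻¹' {y | (y : ℝ) ≤ t}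
  have hC : MeasurableSet C :=
    (AddCircle.measurableEquivIoc 1 0).measurable
      (measurableSet_le measurable_subtype_coe measurable_const)
  refine ⟨event volume C hC, ?_⟩
  rw [event_inf, dist_bot_event, dist_bot_event, ← ht, hvol _ (hA.inter hC)]
  congr 1
  ext x
  simp only [A', preimage_inter, mem_inter_iff, mem_preimage, mem_Iic]
  constructor
  · rintro ⟨⟨hxA, hxC⟩, hx⟩
    refine ⟨⟨hxA, hx⟩, ?_⟩
    have : (AddCircle.equivIoc 1 0 (x : Circle1) : ℝ) ≤ t := hxC
    rwa [AddCircle.equivIoc_coe_of_mem hx] at this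
  · rintro ⟨⟨hxA, hx⟩, hxt⟩
    refine ⟨⟨hxA, ?_⟩, hx⟩
    change (AddCircle.equivIoc 1 0 (x : Circle1) : ℝ) ≤ t
    rwa [AddCircle.equivIoc_coe_of_mem hx]

theorem aperiodic_rotation {α : ℝ} (hα : Irrational α) :
    IsAperiodic (rotation (α : Circle1)) := by
  intro a ha n hn
  obtain ⟨c, hc⟩ := atomless_circle a
  have hapos : 0 < dist ⊥ a := dist_pos.2 ha.symm
  have ha1 : dist ⊥ a ≤ 1 := IsProbabilityAlgebra.dist_le_one _ _
  refine ⟨a ⊓ c, inf_le_left, fun hfix => ?_⟩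
  rw [rotation_iterate] at hfix
  generalize a ⊓ c = b at hc hfix
  induction b using event_ind with | _ B hB
  rw [rotation_event, event_eq_iff] at hfix
  have herg : Ergodic (fun x : Circle1 => -(n • (α : Circle1)) + x) volume := by
    rw [AddCircle.ergodic_add_left, addOrderOf_eq_zero_iff]
    have : -(n • (α : Circle1)) = ((-(n * α) : ℝ) : Circle1) := by simp
    rw [this, AddCircle.isOfFinAddOrder_iff_exists_rat_eq_div]
    rintro ⟨q, hq⟩
    have hirr : Irrational (-(n * α)) := (hα.natCast_mul hn.ne').neg
    exact hirr ⟨q, by simpa using hq⟩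
  rw [dist_bot_event] at hc
  rcases herg.quasiErgodic.ae_empty_or_univ₀ hB.nullMeasurableSet hfix with h | h
  · rw [measureReal_congr h, measureReal_empty] at hc
    linarith
  · rw [measureReal_congr h, probReal_univ] at hc
    linarith

/-- For irrational `α`, the circle with the rotation by `2πα` is a model. -/
def circleModel (α : ℝ) (hα : Irrational α) : Model where
  carrier := CircleAlgebra
  τ := rotation (α : Circle1)
  isometry := isometry_rotation _
  atomless := atomless_circle
  aperiodic := aperiodic_rotation hα

/-- The half-circle `[0, 1/2]` in `ℝ / ℤ`. -/
def halfCircle : Set Circle1 := (fun t : ℝ => (t : Circle1)) '' Icc 0 (1 / 2)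

theorem measurableSet_halfCircle : MeasurableSet halfCircle :=
  (isCompact_Icc.image (AddCircle.continuous_mk' 1)).measurableSet

/-- The type `p_α` of the half-circle under the rotation by `2πα`. -/
def halfCircleType (α : ℝ) (hα : Irrational α) : TypeSpace 1 :=
  typeOf (M := circleModel α hα) ![event volume halfCircle measurableSet_halfCircle]

end APrA

end

/-! The invariant that separates the types is the displacement `k ↦ d(τ^k x, x)`. Each value is an
atomic formula, so it depends only on the type of `x`, and it is 2-Lipschitz in `x` because `τ` is
an isometry. For the half-circle under rotation by `α` it is a continuous function of the angle
`kα`, equal to 0 at angle 0 and to 1 at a half turn.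

If `1, α, β` are independent over `ℚ`, Kronecker's theorem (`denseRange_nsmul`) gives `k` with `kα`
near 0 and `kβ` near 1/2. Then `τ^k` barely moves a realisation `a` of `p_α` and nearly complements
a realisation `b` of `p_β`, so the Lipschitz bound forces `1 ≤ 2 d(a, b)`.

A Hamel basis of `ℝ` over `ℚ` containing 1 supplies continuum many pairwise admissible angles. The
estimate `one_le_two_mul_dist_add` also compares realisations in two different models, linked by
elements of equal type. This replaces a triangle inequality for `typeDist` in the refutation of
smallness. -/

namespace UnitAddTorus

/-! ### Kronecker's theorem on the torus -/

open Filter Topology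

variable {d : Type*} [Fintype d]

theorem mFourier_apply_add (n : d → ℤ) (x y : UnitAddTorus d) :
    mFourier n (x + y) = mFourier n x * mFourier n y := by
  simp [mFourier, fourier_apply, AddCircle.toCircle_add, Finset.prod_mul_distrib, smul_add]

theorem mFourier_apply_zero (n : d → ℤ) : mFourier n (0 : UnitAddTorus d) = 1 := by
  simp [mFourier]

theorem mFourier_apply_nsmul (n : d → ℤ) (k : ℕ) (x : UnitAddTorus d) :
    mFourier n (k • x) = mFourier n x ^ k := by
  induction k with
  | zero => simp [mFourier_apply_zero]
  | succ k ih => rw [succ_nsmul, mFourier_apply_add, ih, pow_succ]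

theorem norm_mFourier_apply (n : d → ℤ) (x : UnitAddTorus d) : ‖mFourier n x‖ = 1 := by
  simp [mFourier, Circle.norm_coe]

/-- Translating by `θ` preserves the integral but multiplies the character by a constant other than
1. -/
theorem integral_mFourier_eq_zero {n : d → ℤ} {θ : UnitAddTorus d} (h : mFourier n θ ≠ 1) :
    ∫ x, mFourier n x = 0 := by
  have key : ∫ x, mFourier n x = mFourier n θ * ∫ x, mFourier n x := by
    rw [← integral_const_mul, ← integral_add_left_eq_self (fun x => mFourier n x) θ]
    simp only [mFourier_apply_add]
  have h2 : (mFourier n θ - 1) * ∫ x, mFourier n x = 0 := by rw [sub_mul, ← key, one_mul, sub_self]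
  exact (mul_eq_zero.1 h2).resolve_left (sub_ne_zero.2 h)

/-- The Birkhoff averages of trigonometric polynomials along the orbit of `0` under a
translation that is not annihilated by any nontrivial character. -/
theorem tendsto_average_of_mem_span {θ : UnitAddTorus d} (h : ∀ n ≠ 0, mFourier n θ ≠ 1)
    {p : C(UnitAddTorus d, ℂ)} (hp : p ∈ Submodule.span ℂ (range (mFourier (d := d)))) :
    Tendsto (fun N : ℕ => (N : ℂ)⁻¹ * ∑ k ∈ Finset.range N, p (k • θ)) atTop (𝓝 (∫ x, p x)) := by
  induction hp using Submodule.span_induction with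
  | mem p hp =>
    obtain ⟨n, rfl⟩ := hp
    simp only [mFourier_apply_nsmul]
    rcases eq_or_ne n 0 with rfl | hn
    · refine tendsto_const_nhds.congr' ?_
      filter_upwards [eventually_ne_atTop 0] with N hN
      simp [mFourier_zero, hN]
    -- The orbit sum is geometric with ratio of modulus 1, hence bounded independently of `N`.
    · rw [integral_mFourier_eq_zero (h n hn)]
      refine squeeze_zero_norm (a := fun N : ℕ => (N : ℝ)⁻¹ * (2 / ‖mFourier n θ - 1‖))
        (fun N => ?_) ?_
      · rw [geom_sum_eq (h n hn), norm_mul, norm_inv, norm_div, Complex.norm_natCast]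
        gcongr
        refine (norm_sub_le _ _).trans ?_
        rw [norm_pow, norm_mFourier_apply]
        norm_num
      · simpa using (tendsto_inv_atTop_nhds_zero_nat (𝕜 := ℝ)).mul_const
          (2 / ‖mFourier n θ - 1‖)
  | zero => simp
  | add p q _ _ hp hq =>
    simp only [ContinuousMap.add_apply, Finset.sum_add_distrib, mul_add]
    rw [integral_add]
    · exact hp.add hq
    · exact p.continuous.integrable_of_hasCompactSupport (.of_compactSpace _)
    · exact q.continuous.integrable_of_hasCompactSupport (.of_compactSpace _)
  | smul c p _ hp =>
    simp only [ContinuousMap.smul_apply, smul_eq_mul, ← Finset.mul_sum]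
    rw [integral_const_mul]
    simpa only [mul_left_comm] using hp.const_mul c

/-- **Kronecker's theorem**: the forward orbit of a translation of the torus that is not
annihilated by any nontrivial character is dense. -/
theorem denseRange_nsmul {θ : UnitAddTorus d} (h : ∀ n ≠ 0, mFourier n θ ≠ 1) :
    DenseRange (fun k : ℕ => k • θ) := by
  intro x
  by_contra hx
  -- A Urysohn function vanishing on the orbit has all its orbit averages 0 but a positive integral,
  -- which contradicts equidistribution.
  obtain ⟨f, hf0, hf1, hf⟩ := exists_continuous_zero_one_of_isClosed
    (isClosed_closure (s := range fun k : ℕ => k • θ)) (isClosed_singleton (x := x))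
    (disjoint_singleton_right.2 hx)
  have hpos : 0 < ∫ y, f y :=
    f.continuous.integral_pos_of_hasCompactSupport_nonneg_nonzero (.of_compactSpace _)
      (fun y => (hf y).1) (x := x) (by simp [hf1 (mem_singleton x)])
  let F : C(UnitAddTorus d, ℂ) := ⟨fun y => (f y : ℂ), by fun_prop⟩
  have hF : F ∈ closure (Submodule.span ℂ (range (mFourier (d := d))) : Set _) := by
    rw [← Submodule.topologicalClosure_coe, span_mFourier_closure_eq_top]
    trivial
  -- The approximation error enters twice, in the orbit averages and in the integral. With a third
  -- of `∫ f` each time, the total stays below `∫ f`.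
  obtain ⟨p, hp, hFp⟩ := Metric.mem_closure_iff.1 hF ((∫ y, f y) / 3) (by positivity)
  have hdist : ∀ y, ‖p y - F y‖ ≤ (∫ y, f y) / 3 := fun y => by
    rw [← dist_eq_norm, dist_comm]
    exact (ContinuousMap.dist_apply_le_dist y).trans hFp.le
  have h1 : ‖∫ y, p y‖ ≤ (∫ y, f y) / 3 := by
    refine le_of_tendsto (tendsto_average_of_mem_span h hp).norm
      (eventually_ne_atTop 0 |>.mono fun N hN => ?_)
    rw [norm_mul, norm_inv, Complex.norm_natCast, inv_mul_le_iff₀ (by positivity)]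
    refine (norm_sum_le _ _).trans ((Finset.sum_le_card_nsmul _ _ ((∫ y, f y) / 3) ?_).trans ?_)
    · intro k _
      have h0 : F (k • θ) = 0 := by
        have := hf0 (subset_closure (mem_range_self k))
        simpa [F] using this
      simpa [h0] using hdist (k • θ)
    · simp
  have h2 : ‖(∫ y, p y) - ∫ y, F y‖ ≤ (∫ y, f y) / 3 := by
    rw [← integral_sub]
    · exact (norm_integral_le_of_norm_le_const (.of_forall hdist)).trans (by simp)
    · exact p.continuous.integrable_of_hasCompactSupport (.of_compactSpace _)
    · exact F.continuous.integrable_of_hasCompactSupport (.of_compactSpace _)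
  have h3 : ‖∫ y, F y‖ = ∫ y, f y := by
    change ‖∫ y, (f y : ℂ)‖ = _
    rw [integral_complex_ofReal, Complex.norm_real, Real.norm_of_nonneg hpos.le]
  have h4 := norm_sub_norm_le (∫ y, F y) (∫ y, p y)
  rw [norm_sub_rev] at h4
  linarith

end UnitAddTorus

namespace APrA

open Filter Topology

/-! ### Simultaneous approximation -/

/-- A character `n` trivial at `(α, β)` means that `n₀α + n₁β` is an integer, and independence then
forces `n = 0`. -/
theorem dense_nsmul_of_linearIndependent {α β : ℝ} (h : LinearIndependent ℚ ![1, α, β]) :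
    DenseRange fun k : ℕ => k • (![α, β] : UnitAddTorus (Fin 2)) := by
  refine UnitAddTorus.denseRange_nsmul fun n hn h1 => hn ?_
  have h2 : AddCircle.toCircle (n 0 • (α : Circle1) + n 1 • (β : Circle1)) = 1 := by
    rw [AddCircle.toCircle_add]
    ext
    simpa [UnitAddTorus.mFourier, fourier_apply] using h1
  have h3 : ((n 0 • α + n 1 • β : ℝ) : Circle1) = 0 := by
    rw [← AddCircle.toCircle_zero] at h2
    simpa using AddCircle.injective_toCircle one_ne_zero h2
  obtain ⟨m, hm⟩ := (AddCircle.coe_eq_zero_iff 1).1 h3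
  rw [Fintype.linearIndependent_iff] at h
  have h4 := h ![-m, n 0, n 1] (by
    simp only [Fin.sum_univ_three, Rat.smul_def, zsmul_eq_mul] at hm ⊢
    simp at hm ⊢
    linarith)
  ext i
  fin_cases i
  · simpa using h4 1
  · simpa using h4 2

theorem exists_nsmul_mem_nhds {α β : ℝ} (h : LinearIndependent ℚ ![1, α, β]) {x y : Circle1}
    {U V : Set Circle1} (hU : U ∈ 𝓝 x) (hV : V ∈ 𝓝 y) :
    ∃ k : ℕ, k • (α : Circle1) ∈ U ∧ k • (β : Circle1) ∈ V := by
  have hU' : ∀ᶠ z : UnitAddTorus (Fin 2) in 𝓝 ![x, y], z 0 ∈ U :=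
    (continuous_apply (0 : Fin 2)).continuousAt.eventually hU
  have hV' : ∀ᶠ z : UnitAddTorus (Fin 2) in 𝓝 ![x, y], z 1 ∈ V :=
    (continuous_apply (1 : Fin 2)).continuousAt.eventually hV
  obtain ⟨_, ⟨k, rfl⟩, hz, hz'⟩ :=
    (dense_nsmul_of_linearIndependent h).inter_nhds_nonempty (hU'.and hV')
  exact ⟨k, hz, hz'⟩

/-! ### Displacement of the half-circle -/

/-- Rotations depend continuously on the angle in the compact-open topology, and for
measure-preserving maps this makes preimages of a fixed measurable set converge in measure. -/
theorem continuous_rotation_apply (a : CircleAlgebra) : Continuous fun x => rotation x a := by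
  induction a using event_ind with | _ A hA
  refine continuous_iff_continuousAt.2 fun x => tendsto_iff_dist_tendsto_zero.2 ?_
  simp only [rotation_event, dist_event]
  let f : Circle1 → C(Circle1, Circle1) := fun y => ⟨fun z => -y + z, by fun_prop⟩
  have hf : Continuous f := ContinuousMap.continuous_of_continuous_uncurry _ (by
    change Continuous fun p : Circle1 × Circle1 => -p.1 + p.2
    fun_prop)
  have h : Tendsto (fun y => volume ((f y ⁻¹' A) ∆ (f x ⁻¹' A))) (𝓝 x) (𝓝 0) :=
    tendsto_measure_symmDiff_preimage_nhds_zero hf.continuousAt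
      (.of_forall fun y => measurePreserving_add_left volume (-y))
      (measurePreserving_add_left volume (-x)) hA.nullMeasurableSet (measure_ne_top _ _)
  exact (ENNReal.tendsto_toReal ENNReal.zero_ne_top).comp h

theorem rotation_zero (a : CircleAlgebra) : rotation 0 a = a := (rotation_iterate 0 0 a).symm.trans rfl

/-- The half-circle, as an event. -/
noncomputable abbrev halfCircleEvent : CircleAlgebra :=
  event volume halfCircle measurableSet_halfCircle

theorem mem_halfCircle_iff {t : ℝ} (ht : t ∈ Ico (0 : ℝ) 1) :
    (t : Circle1) ∈ halfCircle ↔ t ≤ 1 / 2 := by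
  constructor
  · rintro ⟨s, hs, hst⟩
    have : s = t := by
      refine (AddCircle.coe_eq_coe_iff_of_mem_Ico (p := 1) (a := 0) ?_ (by simpa using ht)).1 hst
      have := hs.1; have := hs.2
      constructor <;> linarith
    exact this ▸ hs.2
  · exact fun h => ⟨t, ⟨ht.1, h⟩, rfl⟩

theorem volume_singleton (x : Circle1) : volume {x} = 0 := by
  simp [← Metric.closedBall_zero, AddCircle.volume_closedBall]

/-- A half turn carries the half-circle to its complement, up to the two endpoints 0 and 1/2. -/
theorem dist_rotation_half_halfCircleEvent :
    dist (rotation ((1 / 2 : ℝ) : Circle1) halfCircleEvent) halfCircleEvent = 1 := by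
  rw [rotation_event, dist_event]
  refine (measureReal_congr ?_).trans probReal_univ
  have hnull : volume ({0, ((1 / 2 : ℝ) : Circle1)} : Set Circle1) = 0 :=
    measure_union_null (s := {0}) (volume_singleton 0) (volume_singleton _)
  refine eventuallyEq_univ.2 ?_
  filter_upwards [compl_mem_ae_iff.2 hnull] with x hx
  obtain ⟨t, ht, rfl⟩ := AddCircle.coe_image_Ico_eq (p := (1 : ℝ)) 0 ▸ mem_univ x
  rw [zero_add] at ht
  have ht0 : t ≠ 0 := by rintro rfl; simp at hx
  have ht2 : t ≠ 1 / 2 := by rintro rfl; simp at hx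
  rw [mem_symmDiff, mem_preimage, mem_halfCircle_iff ht]
  rcases lt_or_gt_of_ne ht2 with h | h
  -- Here `t - 1/2` is negative, so a period is added to obtain the representative in `[0, 1)`.
  · have : -((1 / 2 : ℝ) : Circle1) + (t : Circle1) = ((t + 1 / 2 : ℝ) : Circle1) := by
      rw [← AddCircle.coe_neg, ← AddCircle.coe_add, ← AddCircle.coe_add_period 1 (_ + t)]
      congr 1
      ring
    rw [this, mem_halfCircle_iff ⟨by linarith [ht.1], by linarith⟩]
    have := lt_of_le_of_ne ht.1 ht0.symm
    exact Or.inr ⟨h.le, by linarith⟩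
  · have : -((1 / 2 : ℝ) : Circle1) + (t : Circle1) = ((t - 1 / 2 : ℝ) : Circle1) := by
      rw [← AddCircle.coe_neg, ← AddCircle.coe_add, neg_add_eq_sub]
    rw [this, mem_halfCircle_iff ⟨by linarith [ht.1], by linarith [ht.2]⟩]
    exact Or.inl ⟨by linarith [ht.2], by linarith⟩

/-! ### Displacement is part of the type -/

/-- The term `τ^k(x)`. -/
def iterateTerm (k : ℕ) : lang.Term (Fin 1) :=
  (fun t => FirstOrder.Language.Term.func (L := lang) Symb.tau fun _ => t)^[k] (.var 0)

theorem realize_iterateTerm {M : Model} (k : ℕ) (a : Fin 1 → M) :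
    (iterateTerm k).realize a = M.τ^[k] (a 0) := by
  induction k with
  | zero => rfl
  | succ k ih =>
    rw [iterateTerm, Function.iterate_succ_apply', Function.iterate_succ_apply', ← ih]
    rfl

theorem dist_iterate_eq_of_typeOf_eq {M M' : Model} {a : Fin 1 → M} {b : Fin 1 → M'}
    (h : typeOf a = typeOf b) (k : ℕ) :
    dist (M.τ^[k] (a 0)) (a 0) = dist (M'.τ^[k] (b 0)) (b 0) := by
  have h2 : ((tp a (.dist (iterateTerm k) (.var 0)) : I) : ℝ) =
      (tp b (.dist (iterateTerm k) (.var 0)) : I) :=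
    congrArg Subtype.val (congrFun (show tp a = tp b from congrArg Subtype.val h) _)
  simpa [tp, Formula.value, realize_iterateTerm] using h2

theorem dist_iterate_of_typeOf_eq_halfCircleType {M : Model} {a : Fin 1 → M} {α : ℝ}
    {hα : Irrational α} (h : typeOf a = halfCircleType α hα) (k : ℕ) :
    dist (M.τ^[k] (a 0)) (a 0) =
      dist (rotation (k • (α : Circle1)) halfCircleEvent) halfCircleEvent := by
  rw [dist_iterate_eq_of_typeOf_eq h k, ← rotation_iterate]
  rfl

/-- `τ^k` is an isometry, so replacing `a` by `c` costs `dist a c` at each end of the displacement.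
-/
theorem dist_iterate_le {M : Model} (a c : M) (k : ℕ) :
    dist (M.τ^[k] a) a ≤ 2 * dist a c + dist (M.τ^[k] c) c := by
  have h : dist (M.τ^[k] a) (M.τ^[k] c) = dist a c := by
    induction k with
    | zero => rfl
    | succ k ih => rw [Function.iterate_succ_apply', Function.iterate_succ_apply',
        M.isometry.dist_eq, ih]
  have := dist_triangle4 (M.τ^[k] a) (M.τ^[k] c) c a
  rw [h, dist_comm c a] at this
  linarith

/-- If `a`, `b` realise `p_α`, `p_β` in two models and `c`, `c'` have the same type, then `c`
cannot be close to `a` and `c'` close to `b`: some power of `τ` almost fixes `a` and almost maps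
`b` to its complement. -/
theorem one_le_two_mul_dist_add {α β : ℝ} {hα : Irrational α} {hβ : Irrational β}
    (h : LinearIndependent ℚ ![1, α, β]) {M M' : Model} {a c : Fin 1 → M} {b c' : Fin 1 → M'}
    (ha : typeOf a = halfCircleType α hα) (hb : typeOf b = halfCircleType β hβ)
    (hc : typeOf c = typeOf c') : 1 ≤ 2 * dist (a 0) (c 0) + 2 * dist (b 0) (c' 0) := by
  refine le_of_forall_pos_le_add fun ε hε => ?_
  have hcont : Continuous fun x => dist (rotation x halfCircleEvent) halfCircleEvent :=
    (continuous_rotation_apply _).dist continuous_const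
  have hU := hcont.continuousAt.eventually_lt (x₀ := 0) continuousAt_const
    (show _ < ε / 2 by simpa [rotation_zero] using hε)
  have hV := continuousAt_const.eventually_lt (x₀ := ((1 / 2 : ℝ) : Circle1)) hcont.continuousAt
    (show 1 - ε / 2 < _ by rw [dist_rotation_half_halfCircleEvent]; linarith)
  obtain ⟨k, hk, hk'⟩ := exists_nsmul_mem_nhds h hU hV
  simp only [mem_ofPred_eq] at hk hk'
  rw [← dist_iterate_of_typeOf_eq_halfCircleType ha] at hk
  rw [← dist_iterate_of_typeOf_eq_halfCircleType hb] at hk'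
  -- The large displacement of `b` passes to `c'`, then to `c` by equality of types, then to `a`,
  -- whose displacement is small.
  have h1 := dist_iterate_le (b 0) (c' 0) k
  have h2 := dist_iterate_le (c 0) (a 0) k
  rw [dist_iterate_eq_of_typeOf_eq hc k, dist_comm (c 0)] at h2
  linarith

/-! ### Lower bounds for the distance between types -/

theorem half_le_typeDist {α β : ℝ} (hα : Irrational α) (hβ : Irrational β)
    (h : LinearIndependent ℚ ![1, α, β]) :
    1 / 2 ≤ typeDist (halfCircleType α hα) (halfCircleType β hβ) := by
  refine le_iInf fun M => le_iInf fun a => le_iInf fun b => le_iInf fun ha => le_iInf fun hb => ?_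
  -- In a common model both linking elements can be `b` itself, so only the term `2 d(a, b)`
  -- survives.
  have h1 := one_le_two_mul_dist_add h ha hb (c := b) rfl
  rw [dist_self, mul_zero, add_zero] at h1
  refine le_trans ?_ (edist_le_pi_edist a b 0)
  rw [edist_dist, ← ENNReal.ofReal_one, ← ENNReal.ofReal_ofNat 2,
    ← ENNReal.ofReal_div_of_pos two_pos]
  exact ENNReal.ofReal_le_ofReal (by linarith)

theorem typeDist_self {n : ℕ} (p : TypeSpace n) : typeDist p p = 0 := by
  obtain ⟨_, M, a, rfl⟩ := p
  refine le_antisymm ?_ (zero_le)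
  exact iInf_le_of_le M (iInf_le_of_le a (iInf_le_of_le a
    (iInf_le_of_le rfl (iInf_le_of_le rfl (edist_self a).le))))

theorem exists_of_typeDist_lt {n : ℕ} {p q : TypeSpace n} {ε : ℝ≥0∞} (h : typeDist p q < ε) :
    ∃ (M : Model) (a b : Fin n → M), typeOf a = p ∧ typeOf b = q ∧ edist a b < ε := by
  simpa only [typeDist, iInf_lt_iff, exists_prop] using h

/-- No type is within distance `1 / 4` of both `p_α` and `p_β`. -/
theorem not_typeDist_lt_quarter {α β : ℝ} {hα : Irrational α} {hβ : Irrational β}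
    (h : LinearIndependent ℚ ![1, α, β]) {q : TypeSpace 1}
    (hp : typeDist (halfCircleType α hα) q < ENNReal.ofReal (1 / 4))
    (hp' : typeDist (halfCircleType β hβ) q < ENNReal.ofReal (1 / 4)) : False := by
  obtain ⟨M, a, c, ha, hc, hac⟩ := exists_of_typeDist_lt hp
  obtain ⟨M', b, c', hb, hc', hbc⟩ := exists_of_typeDist_lt hp'
  have h1 := one_le_two_mul_dist_add h ha hb (hc.trans hc'.symm)
  rw [edist_lt_ofReal] at hac hbc
  have h2 := dist_le_pi_dist a c 0
  have h3 := dist_le_pi_dist b c' 0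
  linarith

/-! ### Continuum many independent angles -/

/-- Extend `{1}` to a `ℚ`-basis of `ℝ`, which has cardinality `𝔠`, and discard 1. Any two remaining
elements are independent together with 1. -/
theorem exists_linearIndependent_angles : ∃ S : Set ℝ, #S = 𝔠 ∧ (∀ α ∈ S, Irrational α) ∧
    S.Pairwise fun α β => LinearIndependent ℚ ![1, α, β] := by
  have h1 : LinearIndepOn ℚ id ({1} : Set ℝ) := by simp
  have hB : LinearIndepOn ℚ id (h1.extend (subset_univ _)) := h1.linearIndepOn_extend _
  have hmem : (1 : ℝ) ∈ h1.extend (subset_univ _) :=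
    h1.subset_extend (subset_univ _) (mem_singleton 1)
  refine ⟨h1.extend (subset_univ _) \ {1}, ?_, ?_, ?_⟩
  · have hcard : #(h1.extend (subset_univ _)) = 𝔠 :=
      (Module.Basis.extend h1).mk_eq_rank''.trans Real.rank_rat_real
    have hadd := Cardinal.mk_sdiff_add_mk (singleton_subset_iff.2 hmem)
    rw [hcard, Cardinal.mk_singleton] at hadd
    exact Cardinal.eq_of_add_eq_of_aleph0_le ((add_comm _ _).trans hadd)
      (Cardinal.one_lt_aleph0.trans Cardinal.aleph0_lt_continuum)
      Cardinal.aleph0_lt_continuum.le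
  -- A rational basis element `q ≠ 1` would satisfy the relation `(-q) · 1 + 1 · q = 0`.
  · rintro α ⟨hα, hα1⟩ ⟨q, rfl⟩
    have := (hB.mono (t := {1, (q : ℝ)}) (by simp [insert_subset_iff, hmem, hα]))
    rw [LinearIndepOn.pair_iff _ (Ne.symm hα1)] at this
    simpa using this (-q) 1 (by simp [Rat.smul_def])
  · rintro α ⟨hα, hα1⟩ β ⟨hβ, hβ1⟩ hαβ
    have := hB.linearIndependent.comp (ι' := Fin 3)
      ![⟨1, hmem⟩, ⟨α, hα⟩, ⟨β, hβ⟩] (by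
        have h1α : (1 : ℝ) ≠ α := Ne.symm hα1
        have h1β : (1 : ℝ) ≠ β := Ne.symm hβ1
        intro i j hij
        fin_cases i <;> fin_cases j <;> simp_all [eq_comm])
    convert this using 1
    ext i
    fin_cases i <;> rfl

end APrA

theorem lemma3p3 :
    ¬ APrA.IsSmall ∧
    (∀ (α β : ℝ) (hα : Irrational α) (hβ : Irrational β),
      LinearIndependent ℚ ![1, α, β] →
      1 / 2 ≤ APrA.typeDist (APrA.halfCircleType α hα) (APrA.halfCircleType β hβ)) ∧
    (∃ F : Set (APrA.TypeSpace 1),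
      (∀ p ∈ F, ∃ (α : ℝ) (hα : Irrational α), p = APrA.halfCircleType α hα) ∧
      #F = 𝔠 ∧
      F.Pairwise fun p q => 1 / 2 ≤ APrA.typeDist p q) := by
  obtain ⟨S, hcard, hirr, hS⟩ := APrA.exists_linearIndependent_angles
  refine ⟨fun hsmall => ?_, fun α β hα hβ h => APrA.half_le_typeDist hα hβ h,
    range fun α : S => APrA.halfCircleType α (hirr α α.2), ?_, ?_, ?_⟩
  · obtain ⟨D, hD, hdense⟩ := hsmall 1
    -- At radius 1/4 one member of `D` cannot serve two angles, since the strict bounds give `2 · d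
    -- + 2 · d' < 1`. Hence `𝔠` many angles inject into the countable set `D`.
    choose q hqD hq using fun α : S => hdense (APrA.halfCircleType α (hirr α α.2))
      (ENNReal.ofReal (1 / 4)) (by simp)
    have hinj : Function.Injective fun α => (⟨q α, hqD α⟩ : D) := by
      intro α β hαβ
      by_contra hne
      have h := hq β
      rw [← show q α = q β from congrArg Subtype.val hαβ] at h
      exact APrA.not_typeDist_lt_quarter (hS α.2 β.2 (Subtype.coe_ne_coe.2 hne)) (hq α) h
    have hle := Cardinal.mk_le_of_injective hinj
    rw [hcard] at hle
    exact absurd (hle.trans hD.le_aleph0) Cardinal.aleph0_lt_continuum.not_ge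
  · rintro _ ⟨α, rfl⟩
    exact ⟨α, hirr α α.2, rfl⟩
  -- Distinct angles give distinct types: equal types are at distance 0, below the bound 1/2.
  · rw [Cardinal.mk_range_eq _ fun α β hαβ => ?_, hcard]
    by_contra hne
    have h := APrA.half_le_typeDist (hirr α α.2) (hirr β β.2)
      (hS α.2 β.2 (Subtype.coe_ne_coe.2 hne))
    rw [show APrA.halfCircleType α _ = APrA.halfCircleType β _ from hαβ, APrA.typeDist_self] at h
    simp at h
  · rintro _ ⟨α, rfl⟩ _ ⟨β, rfl⟩ hne
    refine APrA.half_le_typeDist _ _ (hS α.2 β.2 fun h => hne ?_)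
    rw [Subtype.ext h]
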